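/- Let $n\ge 2$ and let $\Delta^n$ be the set of probability distributions $x=(x_1,\dots,x_n)$ on $\{1,\dots,n\}$. For $x,y\in\Delta^n$ write $x\sqsubseteq y$ iff there is a permutation $\tau\in S(n)$ such that $x\cdot\tau:=(x_{\tau(1)},\dots,x_{\tau(n)})$ and $y\cdot\tau$ are both decreasing (not necessarily strictly) and $(x\cdot\tau)_i(y\cdot\tau)_{i+1}\le (x\cdot\tau)_{i+1}(y\cdot\tau)_i$ for all $1\le i\le n-1$. Let $\bot=(1/n,\dots,1/n)$ be the least element of $(\Delta^n,\sqsubseteq)$ and let $e_1,\dots,e_n$ be the pure states (point masses). Let $\mathrm{Coord}(\Delta^n)$ be the set of states with at most two distinct values, and let $\mathrm{Ir}_\bot(\Delta^n)$ be the set of $x\in\mathrm{Coord}(\Delta^n)$ having $0$ among their values. For $x\in\mathrm{Ir}_\bot(\Delta^n)$ the $x$-axis is the set consisting of $\bot$ and of all $y\in\mathrm{Coord}(\Delta^n)$ that attain their maximum on exactly the same set of indices as $x$. For $\sigma\in S(n)$ and $y\in\Delta^n$ let $\sigma y\in\Delta^n$ be given by $(\sigma y)_i=y_{\sigma^{-1}(i)}$,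 so that $\sigma e_i=e_{\sigma(i)}$. Then there are exactly $2^n-2$ axes, that is, $|\mathrm{Ir}_\bot(\Delta^n)|=2^n-2$; each axis, ordered by $\sqsubseteq$, is order-isomorphic to $[0,1]$; and for any choice of order-isomorphisms $\theta_x:x\text{-axis}\to[0,1]$, $x\in\mathrm{Ir}_\bot(\Delta^n)$, the order-isomorphisms $h$ of $(\Delta^n,\sqsubseteq)$ onto itself are in bijective correspondence with the pairs $(\sigma,(f_x)_{x\in\mathrm{Ir}_\bot(\Delta^n)})$ consisting of a permutation $\sigma\in S(n)$ and a family of $2^n-2$ order-isomorphisms $f_x:[0,1]\to[0,1]$. Here $h$ corresponds to $(\sigma,(f_x)_x)$ if and only if $h(e_i)=e_{\sigma(i)}$ for all $i$ (so $\sigma$ relabels the pure states) and $h(y)=\sigma\bigl(\theta_x^{-1}(f_x(\theta_x(y)))\bigr)$ for all $x\in\mathrm{Ir}_\bot(\Delta^n)$ and all $y$ in the $x$-axis (so $f_x$ gauges the $x$-axis). -/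

import Mathlib

namespace BayesianOrder

/-- The set `Δⁿ` of probability distributions on an `n`-element set. It is a fresh structure, so that
it does not inherit the pointwise order of functions. -/
structure State (n : ℕ) where
  val : Fin n → ℝ
  mem : val ∈ stdSimplex ℝ (Fin n)

instance (n : ℕ) : CoeFun (State n) (fun _ => Fin n → ℝ) := ⟨State.val⟩

/-- The Bayesian order: some permutation makes both `x` and `y` decreasing, and the rearranged
distributions satisfy `xᵢ yᵢ₊₁ ≤ xᵢ₊₁ yᵢ` for all neighbouring indices. -/
instance (n : ℕ) : LE (State n) where
  le x y := ∃ σ : Equiv.Perm (Fin n),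
    Antitone (fun i => x (σ i)) ∧ Antitone (fun i => y (σ i)) ∧
    ∀ (i : ℕ) (hi : i + 1 < n),
      x (σ ⟨i, Nat.lt_of_succ_lt hi⟩) * y (σ ⟨i + 1, hi⟩) ≤
        x (σ ⟨i + 1, hi⟩) * y (σ ⟨i, Nat.lt_of_succ_lt hi⟩)

/-- The pure state `eᵢ`. -/
def pureState {n : ℕ} (i : Fin n) : State n := ⟨Pi.single i 1, single_mem_stdSimplex ℝ i⟩

/-- The relabelling of a state along `σ`; it sends `eᵢ` to `e_{σ i}`. -/
def relabel {n : ℕ} (σ : Equiv.Perm (Fin n)) (x : State n) : State n :=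
  ⟨fun i => x (σ.symm i), fun i => x.mem.1 (σ.symm i),
    (Equiv.sum_comp σ.symm x.val).trans x.mem.2⟩

/-- The set of values of a state. -/
def spec {n : ℕ} (x : State n) : Set ℝ := Set.range x.val

/-- The coordinates: the states with at most two distinct values. -/
def Coord (n : ℕ) : Set (State n) := {x | (spec x).ncard ≤ 2}

/-- The degenerated coordinates: those with `0` among their values. They label the axes. -/
def Ir (n : ℕ) : Set (State n) := {x | x ∈ Coord n ∧ 0 ∈ spec x}

/-- The set of indices at which a state takes its largest value. -/
def topSet {n : ℕ} (x : State n) : Set (Fin n) := {i | ∀ j, x j ≤ x i}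

/-- The `x`-axis: the coordinates that are largest on the same set of indices as `x`, together with
the bottom element, which is its lower end point. -/
def axis {n : ℕ} (x : State n) : Set (State n) :=
  {y | y ∈ Coord n ∧ (topSet y = topSet x ∨ IsBot y)}

/-- Given charts `θ x` that identify each axis with `[0,1]`, the order-isomorphism `h` has labelling
`σ` and gauges `f`: it sends `eᵢ` to `e_{σ i}`, and on the `x`-axis it is the gauge `f x`, read in
the chart, followed by relabelling along `σ`. -/
def HasData {n : ℕ} (θ : ∀ x : Ir n, axis x.1 ≃o Set.Icc (0 : ℝ) 1) (h : State n ≃o State n)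
    (σ : Equiv.Perm (Fin n)) (f : Ir n → (Set.Icc (0 : ℝ) 1 ≃o Set.Icc (0 : ℝ) 1)) : Prop :=
  (∀ i, h (pureState i) = pureState (σ i)) ∧
  ∀ (x : Ir n) (y : axis x.1), h y = relabel σ ((θ x).symm (f x (θ x y))).1

end BayesianOrder

namespace BayesianOrder

open scoped unitInterval

variable {n : ℕ}

/-! ### The Bayesian order, pairwise -/

/-! For a nonempty proper set `A` of indices let r_A(x) be the largest ratio x_j / x_i with i in
`A`, j outside `A`, truncated at 1. On its upper level sets r_A records the ratios of consecutive
values of x, so x ≤ y iff r_A(y) ≤ r_A(x) for all `A` (`le_iff_ratio_le`): the states embed, order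
reversed, into a cube with one coordinate per face. The state `axisState A t` is the least one with
r_A ≤ t (`axisState_le_iff`), so these states make up the axes, and an automorphism is determined by
its values on them.

Existence: the image in the cube is stable under independent order-isomorphisms φ_A of the
coordinates. The weights w_i = ∏ φ_A(r_A(x)) over the faces `A` missing i telescope along the levels
of x, and their normalization has ratios φ_A(r_A(x)) (`ratio_gauge`).

Rigidity: an automorphism permutes the maximal elements, which are the pure states. Once these are
fixed by a relabelling, the set of top indices is preserved. States with a chain below them lie on
axes, and the top indices tell which axis, so every axis is mapped to itself
(`exists_map_axisState`). -/

theorem State.ext {x y : State n} (h : ∀ i, x i = y i) : x = y := by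
  cases x; cases y
  congr
  exact funext h

theorem State.nonneg (x : State n) (i : Fin n) : 0 ≤ x i := x.mem.1 i

theorem State.sum_eq_one (x : State n) : ∑ i, x i = 1 := x.mem.2

theorem State.exists_pos (x : State n) : ∃ i, 0 < x i := by
  by_contra! h
  have h0 : ∑ i, x i = 0 := Finset.sum_eq_zero fun i _ => le_antisymm (h i) (x.nonneg i)
  rw [x.sum_eq_one] at h0
  exact one_ne_zero h0

/-- Proportional states are equal. -/
theorem State.ext_of_proportional {x y : State n} (h : ∀ i j, x i * y j = x j * y i) : x = y := by
  refine State.ext fun i => ?_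
  have h1 : ∑ j, x i * y j = ∑ j, x j * y i := Finset.sum_congr rfl fun j _ => h i j
  rwa [← Finset.mul_sum, ← Finset.sum_mul, y.sum_eq_one, x.sum_eq_one, mul_one, one_mul] at h1

/-- Two states that are not oppositely ordered at any pair of indices can be sorted
simultaneously. -/
theorem exists_common_sort {x y : Fin n → ℝ} (h : ∀ i j, x j < x i → y j ≤ y i) :
    ∃ τ : Equiv.Perm (Fin n), Antitone (fun i => x (τ i)) ∧ Antitone (fun i => y (τ i)) := by
  -- Sorting lexicographically lets y break the ties of x.
  let f : Fin n → ℝ ×ₗ ℝ := fun i => toLex (-x i, -y i)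
  have key : ∀ a b, a ≤ b → x (Tuple.sort f b) < x (Tuple.sort f a) ∨
      (x (Tuple.sort f a) = x (Tuple.sort f b) ∧ y (Tuple.sort f b) ≤ y (Tuple.sort f a)) := by
    intro a b hab
    simpa [f, Prod.Lex.toLex_le_toLex] using Tuple.monotone_sort f hab
  refine ⟨Tuple.sort f, fun a b hab => ?_, fun a b hab => ?_⟩
  · rcases key a b hab with h1 | ⟨h1, -⟩
    · exact h1.le
    · exact h1.ge
  · rcases key a b hab with h1 | ⟨-, h1⟩
    · exact h _ _ h1
    · exact h1

theorem le_of_mul_le {x y : State n} {i j : Fin n} (hx : x j < x i)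
    (h : x i * y j ≤ x j * y i) : y j ≤ y i := by
  have hi : 0 < x i := (x.nonneg j).trans_lt hx
  exact le_of_mul_le_mul_left (h.trans (mul_le_mul_of_nonneg_right hx.le (y.nonneg i))) hi

/-- The Bayesian order compares the likelihood ratios of all pairs of indices. -/
theorem le_iff {x y : State n} :
    x ≤ y ↔ ∀ i j, x j < x i → x i * y j ≤ x j * y i := by
  constructor
  · rintro ⟨τ, hx, hy, h⟩ i j hij
    have main : ∀ (a : Fin n) (m : ℕ) (hm : a + m < n),
        x (τ a) * y (τ ⟨a + m, hm⟩) ≤ x (τ ⟨a + m, hm⟩) * y (τ a) := by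
      intro a m
      induction m with
      | zero => intro hm; simp
      | succ m ih =>
        intro hm
        have h1 := ih (by omega)
        have h2 := h (a + m) hm
        have h3 : y (τ ⟨a + (m + 1), hm⟩) ≤ y (τ ⟨a + m, by omega⟩) := hy (Fin.mk_le_mk.2 (by omega))
        have h4 : x (τ ⟨a + (m + 1), hm⟩) ≤ x (τ ⟨a + m, by omega⟩) := hx (Fin.mk_le_mk.2 (by omega))
        have ha : 0 ≤ x (τ a) := x.nonneg _
        have ha' : 0 ≤ y (τ a) := y.nonneg _
        have hs : 0 ≤ x (τ ⟨a + (m + 1), hm⟩) := x.nonneg _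
        have hs' : 0 ≤ y (τ ⟨a + (m + 1), hm⟩) := y.nonneg _
        -- Neighbouring inequalities are chained by cancelling the middle values of x and y, so a
        -- vanishing middle value needs its own argument.
        rcases (x.nonneg (τ ⟨a + m, by omega⟩)).eq_or_lt with h0 | h0
        · have h5 : x (τ a) * y (τ ⟨a + m, by omega⟩) ≤ 0 := by simpa [← h0] using h1
          calc _ ≤ x (τ a) * y (τ ⟨a + m, by omega⟩) := mul_le_mul_of_nonneg_left h3 ha
            _ ≤ 0 := h5
            _ ≤ _ := mul_nonneg hs ha'
        · rcases (y.nonneg (τ ⟨a + m, by omega⟩)).eq_or_lt with g0 | g0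
          · rw [le_antisymm (h3.trans g0.ge) hs', mul_zero]
            exact mul_nonneg hs ha'
          · refine le_of_mul_le_mul_left ?_ (mul_pos h0 g0)
            calc _ = (x (τ a) * y (τ ⟨a + m, by omega⟩)) *
                  (x (τ ⟨a + m, by omega⟩) * y (τ ⟨a + (m + 1), hm⟩)) := by ring
              _ ≤ (x (τ ⟨a + m, by omega⟩) * y (τ a)) *
                  (x (τ ⟨a + (m + 1), hm⟩) * y (τ ⟨a + m, by omega⟩)) :=
                mul_le_mul h1 h2 (mul_nonneg h0.le hs') (mul_nonneg h0.le ha')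
              _ = _ := by ring
    obtain ⟨a, rfl⟩ := τ.surjective i
    obtain ⟨b, rfl⟩ := τ.surjective j
    have hab : a < b := by
      by_contra! hba
      exact absurd (hx hba) (not_le.2 hij)
    have := main a (b - a) (by omega)
    have hb : (⟨a + (b - a), by omega⟩ : Fin n) = b := Fin.ext (by simp; omega)
    rwa [hb] at this
  · intro h
    obtain ⟨τ, hx, hy⟩ := exists_common_sort fun i j hij => le_of_mul_le hij (h i j hij)
    refine ⟨τ, hx, hy, fun i hi => ?_⟩
    have hle : (⟨i, Nat.lt_of_succ_lt hi⟩ : Fin n) ≤ ⟨i + 1, hi⟩ := Fin.mk_le_mk.2 (by omega)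
    rcases (hx hle).eq_or_lt with h1 | h1
    · have h1' : x (τ ⟨i + 1, hi⟩) = x (τ ⟨i, Nat.lt_of_succ_lt hi⟩) := h1
      rw [h1']
      exact mul_le_mul_of_nonneg_left (hy hle) (x.nonneg _)
    · exact h _ _ h1

theorem State.le_refl (x : State n) : x ≤ x := le_iff.2 fun _ _ _ => (mul_comm _ _).le

theorem State.le_antisymm {x y : State n} (hxy : x ≤ y) (hyx : y ≤ x) : x = y := by
  have key : ∀ {x y : State n}, x ≤ y → y ≤ x → ∀ i j, x j < x i → x i * y j = x j * y i := by
    intro x y hxy hyx i j hij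
    have h1 := le_iff.1 hxy i j hij
    rcases (le_of_mul_le hij h1).eq_or_lt with h2 | h2
    · rw [h2] at h1 ⊢
      have h3 : y i = 0 := by nlinarith [y.nonneg i]
      simp [h3]
    · have h3 := le_iff.1 hyx i j h2
      linarith
  refine State.ext_of_proportional fun i j => ?_
  rcases lt_trichotomy (x i) (x j) with h | h | h
  · exact (key hxy hyx j i h).symm
  · rcases lt_trichotomy (y i) (y j) with h' | h' | h'
    · linarith [key hyx hxy j i h']
    · rw [h, h']
    · linarith [key hyx hxy i j h']
  · exact key hxy hyx i j h

theorem le_pureState_iff {x : State n} {i : Fin n} : x ≤ pureState i ↔ i ∈ topSet x := by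
  rw [le_iff]
  constructor
  · intro h j
    by_contra! hj
    have := h j i hj
    have hne : j ≠ i := by rintro rfl; exact lt_irrefl _ hj
    simp [pureState, hne] at this
    linarith [x.nonneg i]
  · intro h a b hab
    have hb : b ≠ i := by rintro rfl; exact absurd (h a) (not_le.2 hab)
    simp only [pureState, Pi.single_apply, hb, if_false, mul_zero]
    exact mul_nonneg (x.nonneg b) (by split_ifs <;> simp)

theorem topSet_nonempty (x : State n) : (topSet x).Nonempty := by
  obtain ⟨k, -⟩ := x.exists_pos
  obtain ⟨i, -, hi⟩ := Finset.exists_max_image Finset.univ x.val ⟨k, Finset.mem_univ k⟩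
  exact ⟨i, fun j => hi j (Finset.mem_univ j)⟩

theorem topSet_pureState (i : Fin n) : topSet (pureState i) = {i} := by
  ext j
  refine ⟨fun h => ?_, ?_⟩
  · by_contra hne
    have := h i
    simp [pureState, show j ≠ i from hne] at this
    linarith
  · rintro rfl k
    by_cases hk : k = j <;> simp [pureState, hk]

theorem pureState_injective : Function.Injective (pureState : Fin n → State n) := by
  intro i j h
  have := congrArg topSet h
  rw [topSet_pureState, topSet_pureState] at this
  exact Set.singleton_injective this

/-- Zeros persist upwards in the order. This maximality is what makes automorphisms permute the pure
states. -/
theorem eq_of_pureState_le {x : State n} {i : Fin n} (h : pureState i ≤ x) : x = pureState i := by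
  have hzero : ∀ k, k ≠ i → x k = 0 := by
    intro k hk
    have := le_iff.1 h i k (by simp [pureState, hk])
    simp [pureState, hk] at this
    exact _root_.le_antisymm this (x.nonneg k)
  refine State.ext_of_proportional fun a b => ?_
  by_cases ha : a = i <;> by_cases hb : b = i <;> simp [pureState, ha, hb, hzero]

theorem isBot_iff {x : State n} : IsBot x ↔ ∀ i j, x i = x j := by
  constructor
  · intro h i j
    have key : ∀ i j, x i ≤ x j := by
      intro i j
      exact le_pureState_iff.1 (h (pureState j)) i
    exact _root_.le_antisymm (key i j) (key j i)
  · intro h y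
    exact le_iff.2 fun i j hij => absurd (h j i) hij.ne

/-! ### The ratio of a state across a face -/

/-- The nonempty proper sets of indices. -/
abbrev Face (n : ℕ) := {A : Finset (Fin n) // A.Nonempty ∧ A ≠ Finset.univ}

theorem Face.exists_notMem (A : Face n) : ∃ j, j ∉ A.1 := by
  by_contra! h
  exact A.2.2 (Finset.eq_univ_iff_forall.2 h)

/-- The ratio `a / b`, truncated at `1`, with the conventions `0 / 0 = 0` and `a / 0 = 1` for
`a > 0`. -/
noncomputable def truncRatio (a b : ℝ) : I :=
  if a ≤ 0 then 0 else if h : 0 < a ∧ a < b then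
    ⟨a / b, div_nonneg h.1.le (h.1.trans h.2).le, (div_le_one (h.1.trans h.2)).2 h.2.le⟩ else 1

/-- The conventions at `b = 0` are those that make this division-free form hold without exception.
Truncation destroys it at `t = 1`, whence the recurring case split there. -/
theorem truncRatio_le_iff {a b : ℝ} (hb : 0 ≤ b) {t : I} (ht : t < 1) :
    truncRatio a b ≤ t ↔ a ≤ t * b := by
  have ht1 : (t : ℝ) < 1 := ht
  have ht0 : (0 : ℝ) ≤ t := t.2.1
  unfold truncRatio
  split_ifs with h1 h2
  · exact ⟨fun _ => h1.trans (mul_nonneg ht0 hb), fun _ => t.2.1⟩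
  · rw [← Subtype.coe_le_coe]
    exact div_le_iff₀ (h2.1.trans h2.2)
  · refine ⟨fun h => absurd h (not_le.2 ht), fun h => absurd ?_ h2⟩
    have ha : 0 < a := not_le.1 h1
    refine ⟨ha, ?_⟩
    by_contra! hba
    nlinarith

/-- The largest ratio of a value off the face `A` to a value on it. -/
noncomputable def ratio (A : Face n) (x : State n) : I :=
  (A.1ᶜ ×ˢ A.1).sup fun p => truncRatio (x p.1) (x p.2)

theorem ratio_le_iff {A : Face n} {x : State n} {t : I} (ht : t < 1) :
    ratio A x ≤ t ↔ ∀ i ∈ A.1, ∀ j ∉ A.1, x j ≤ t * x i := by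
  rw [ratio, Finset.sup_le_iff]
  constructor
  · intro h i hi j hj
    exact (truncRatio_le_iff (x.nonneg i) ht).1 (h (j, i) (by simp [hi, hj]))
  · rintro h ⟨j, i⟩ hij
    simp only [Finset.mem_product, Finset.mem_compl] at hij
    exact (truncRatio_le_iff (x.nonneg i) ht).2 (h i hij.2 j hij.1)

theorem le_ratio_mul {A : Face n} {x : State n} (h : ratio A x < 1) {i j : Fin n} (hi : i ∈ A.1)
    (hj : j ∉ A.1) : x j ≤ ratio A x * x i :=
  (ratio_le_iff h).1 le_rfl i hi j hj

/-- A ratio below 1 makes `A` an upper level set, up to indices where x vanishes; positivity of `x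
j` excludes 0 / 0. -/
theorem lt_of_ratio_lt_one {A : Face n} {x : State n} (h : ratio A x < 1) {i j : Fin n}
    (hi : i ∈ A.1) (hj : j ∉ A.1) (hpos : 0 < x j) : x j < x i := by
  have h1 := le_ratio_mul h hi hj
  have h2 : (ratio A x : ℝ) < 1 := h
  have h3 : 0 < x i := pos_of_mul_pos_right (hpos.trans_le h1) (ratio A x).2.1
  nlinarith

theorem eq_zero_of_ratio_eq_zero {A : Face n} {x : State n} (h : ratio A x = 0) {j : Fin n}
    (hj : j ∉ A.1) : x j = 0 := by
  obtain ⟨i, hi⟩ := A.2.1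
  have := le_ratio_mul (h.trans_lt zero_lt_one) hi hj
  rw [h] at this
  exact _root_.le_antisymm (by simpa using this) (x.nonneg j)

theorem ratio_antitone {x y : State n} (hxy : x ≤ y) (A : Face n) : ratio A y ≤ ratio A x := by
  rcases eq_or_lt_of_le (unitInterval.le_one' : ratio A x ≤ 1) with h1 | h1
  · rw [h1]; exact unitInterval.le_one'
  refine (ratio_le_iff h1).2 fun i hi j hj => ?_
  have h2 := le_ratio_mul h1 hi hj
  have h3 : (ratio A x : ℝ) < 1 := h1
  rcases (x.nonneg i).eq_or_lt with h0 | h0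
  · rw [← h0, mul_zero] at h2
    have hj0 : x j = 0 := _root_.le_antisymm h2 (x.nonneg j)
    obtain ⟨k, hk⟩ := x.exists_pos
    have h4 := le_iff.1 hxy k j (hj0.trans_lt hk)
    rw [hj0, zero_mul] at h4
    have : y j ≤ 0 := nonpos_of_mul_nonpos_right h4 hk
    exact this.trans (mul_nonneg (ratio A x).2.1 (y.nonneg i))
  · have h4 := le_iff.1 hxy i j (by nlinarith)
    refine le_of_mul_le_mul_left ?_ h0
    calc _ ≤ x j * y i := h4
      _ ≤ (ratio A x * x i) * y i := mul_le_mul_of_nonneg_right h2 (y.nonneg i)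
      _ = _ := by ring

/-- The set of indices at which `x` is at least `x i`, as a face, if `x i` is not the smallest
value. -/
noncomputable def upperFace (x : State n) {i j : Fin n} (h : x j < x i) : Face n :=
  ⟨Finset.univ.filter fun k => x i ≤ x k, ⟨i, by simp⟩, fun hA => by
    have := Finset.eq_univ_iff_forall.1 hA j
    simp at this
    linarith⟩

theorem mem_upperFace {x : State n} {i j k : Fin n} {h : x j < x i} :
    k ∈ (upperFace x h).1 ↔ x i ≤ x k := by
  simp [upperFace]

theorem le_iff_ratio_le {x y : State n} : x ≤ y ↔ ∀ A, ratio A y ≤ ratio A x := by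
  refine ⟨ratio_antitone, fun h => ?_⟩
  have hpos : ∀ {i j}, x j < x i → 0 < x i := fun h => (x.nonneg _).trans_lt h
  -- the upper face of `x i` bounds `y j / y i` by every bound for the lower values of `x`
  have key : ∀ i j (hij : x j < x i) (m : ℝ), 0 ≤ m → m < x i →
      (∀ k, x k < x i → x k ≤ m) → x i * y j ≤ m * y i := by
    intro i j hij m hm0 hmi hm
    have hi := hpos hij
    let t : I := ⟨m / x i, div_nonneg hm0 hi.le, (div_le_one hi).2 hmi.le⟩
    have ht : t < 1 := Subtype.coe_lt_coe.1 ((div_lt_one hi).2 hmi)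
    have h1 : ratio (upperFace x hij) x ≤ t := by
      refine (ratio_le_iff ht).2 fun a ha b hb => ?_
      rw [mem_upperFace] at ha hb
      refine (hm b (not_le.1 hb)).trans ?_
      rw [show (t : ℝ) = m / x i from rfl, div_mul_eq_mul_div, le_div_iff₀ hi]
      exact mul_le_mul_of_nonneg_left ha hm0
    have h2 := (ratio_le_iff ht).1 ((h _).trans h1) i (mem_upperFace.2 le_rfl) j
      (by rw [mem_upperFace]; exact not_le.2 hij)
    rw [show (t : ℝ) = m / x i from rfl, div_mul_eq_mul_div, le_div_iff₀ hi] at h2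
    linarith
  have hcom : ∀ i j, x j < x i → y j ≤ y i := by
    intro i j hij
    -- The next lower value of x is the sharpest bound available; being below `x i`, it already
    -- rules out opposite orderings, so a common sorting exists.
    obtain ⟨k, hk, hmax⟩ := Finset.exists_max_image (Finset.univ.filter fun k => x k < x i) x.val
      ⟨j, by simpa using hij⟩
    simp only [Finset.mem_filter, Finset.mem_univ, true_and] at hk hmax
    have := key i j hij (x k) (x.nonneg k) hk hmax
    exact le_of_mul_le_mul_left (this.trans (mul_le_mul_of_nonneg_right hk.le (y.nonneg i)))
      (hpos hij)
  obtain ⟨τ, hx, hy⟩ := exists_common_sort hcom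
  refine ⟨τ, hx, hy, fun i hi => ?_⟩
  have hle : (⟨i, Nat.lt_of_succ_lt hi⟩ : Fin n) ≤ ⟨i + 1, hi⟩ := Fin.mk_le_mk.2 (by omega)
  rcases (hx hle).eq_or_lt with h1 | h1
  · have h1' : x (τ ⟨i + 1, hi⟩) = x (τ ⟨i, Nat.lt_of_succ_lt hi⟩) := h1
    rw [h1']
    exact mul_le_mul_of_nonneg_left (hy hle) (x.nonneg _)
  · refine key _ _ h1 _ (x.nonneg _) h1 fun k hk => ?_
    obtain ⟨a, rfl⟩ := τ.surjective k
    refine hx (Fin.mk_le_of_le_val ?_)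
    by_contra! ha
    exact absurd (hx (show a ≤ ⟨i, Nat.lt_of_succ_lt hi⟩ from Nat.lt_succ_iff.1 ha)) (not_le.2 hk)

theorem State.ext_ratio {x y : State n} (h : ∀ A, ratio A x = ratio A y) : x = y :=
  State.le_antisymm (le_iff_ratio_le.2 fun A => (h A).ge) (le_iff_ratio_le.2 fun A => (h A).le)

/-! ### Normalization -/

/-- The state proportional to a nonnegative, nonzero weight. -/
noncomputable def normalize (w : Fin n → ℝ) (h0 : ∀ i, 0 ≤ w i) (hpos : ∃ i, 0 < w i) : State n :=
  ⟨fun i => w i / ∑ j, w j, fun i => div_nonneg (h0 i) (Finset.sum_nonneg fun j _ => h0 j), by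
    obtain ⟨i, hi⟩ := hpos
    have : 0 < ∑ j, w j :=
      Finset.sum_pos' (fun j _ => h0 j) ⟨i, Finset.mem_univ i, hi⟩
    rw [← Finset.sum_div, div_self this.ne']⟩

theorem exists_normalize_eq (w : Fin n → ℝ) (h0 : ∀ i, 0 ≤ w i) (hpos : ∃ i, 0 < w i) :
    ∃ c : ℝ, 0 < c ∧ ∀ i, normalize w h0 hpos i = c * w i := by
  obtain ⟨i, hi⟩ := hpos
  have : 0 < ∑ j, w j := Finset.sum_pos' (fun j _ => h0 j) ⟨i, Finset.mem_univ i, hi⟩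
  exact ⟨(∑ j, w j)⁻¹, inv_pos.2 this, fun i => div_eq_inv_mul _ _⟩

/-! ### The states of an axis -/

/-- The state proportional to `1` on the face `A` and to `t` off it. -/
noncomputable def axisState (A : Face n) (t : I) : State n :=
  normalize (fun i => if i ∈ A.1 then 1 else (t : ℝ))
    (fun i => by
      split_ifs
      · exact zero_le_one
      · exact t.2.1)
    (by obtain ⟨i, hi⟩ := A.2.1; exact ⟨i, by simp [hi]⟩)

theorem exists_axisState_eq (A : Face n) (t : I) :
    ∃ c : ℝ, 0 < c ∧ (∀ i ∈ A.1, axisState A t i = c) ∧ ∀ i ∉ A.1, axisState A t i = c * t := by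
  obtain ⟨c, hc, h⟩ := exists_normalize_eq (fun i => if i ∈ A.1 then 1 else (t : ℝ))
    (fun i => by
      split_ifs
      · exact zero_le_one
      · exact t.2.1)
    (by obtain ⟨i, hi⟩ := A.2.1; exact ⟨i, by simp [hi]⟩)
  exact ⟨c, hc, fun i hi => (h i).trans (by simp [hi]), fun i hi => (h i).trans (by simp [hi])⟩

/-- The universal property of the axis states: every ratio is read off from the order alone. At `t =
1` the state is constant and both sides hold trivially. -/
theorem axisState_le_iff {A : Face n} {t : I} {y : State n} :
    axisState A t ≤ y ↔ ratio A y ≤ t := by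
  obtain ⟨c, hc, h1, h2⟩ := exists_axisState_eq A t
  rw [le_iff]
  rcases eq_or_lt_of_le (unitInterval.le_one' : t ≤ 1) with ht | ht
  · have hconst : ∀ i, axisState A t i = c := by
      intro i
      by_cases hi : i ∈ A.1
      · exact h1 i hi
      · rw [h2 i hi, ht]; simp
    refine ⟨fun _ => ht ▸ unitInterval.le_one', fun _ i j hij => ?_⟩
    rw [hconst, hconst] at hij
    exact absurd hij (lt_irrefl c)
  have ht' : (t : ℝ) < 1 := ht
  rw [ratio_le_iff ht]
  constructor
  · intro h i hi j hj
    have := h i j (by rw [h1 i hi, h2 j hj]; nlinarith)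
    rw [h1 i hi, h2 j hj, mul_assoc] at this
    exact le_of_mul_le_mul_left this hc
  · intro h i j hij
    have hct : c * t ≤ c := by nlinarith
    have hi : i ∈ A.1 := by
      by_contra hi
      rw [h2 i hi] at hij
      by_cases hj : j ∈ A.1
      · rw [h1 j hj] at hij; linarith
      · rw [h2 j hj] at hij; exact lt_irrefl _ hij
    have hj : j ∉ A.1 := by
      intro hj
      rw [h1 i hi, h1 j hj] at hij
      exact lt_irrefl _ hij
    rw [h1 i hi, h2 j hj, mul_assoc]
    exact mul_le_mul_of_nonneg_left (h i hi j hj) hc.le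

theorem ratio_axisState (A : Face n) (t : I) : ratio A (axisState A t) = t := by
  refine _root_.le_antisymm (axisState_le_iff.1 (State.le_refl _)) ?_
  obtain ⟨c, hc, h1, h2⟩ := exists_axisState_eq A t
  by_contra! hlt
  obtain ⟨i, hi⟩ := A.2.1
  obtain ⟨j, hj⟩ := A.exists_notMem
  have := le_ratio_mul (hlt.trans_le unitInterval.le_one') hi hj
  rw [h1 i hi, h2 j hj] at this
  have hlt' : (ratio A (axisState A t) : ℝ) < t := hlt
  nlinarith

theorem axisState_le_axisState_iff {A : Face n} {s t : I} :
    axisState A s ≤ axisState A t ↔ t ≤ s := by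
  rw [axisState_le_iff, ratio_axisState]

/-- All values are positive, so a ratio below 1 would make `B` a proper upper level set, and `A` is
the only candidate. At `t = 0` this fails for every `B` containing `A`. -/
theorem ratio_axisState_of_ne {A B : Face n} (h : B ≠ A) {t : I} (ht : 0 < t) :
    ratio B (axisState A t) = 1 := by
  obtain ⟨c, hc, h1, h2⟩ := exists_axisState_eq A t
  by_contra hne
  have hlt : ratio B (axisState A t) < 1 := lt_of_le_of_ne unitInterval.le_one' hne
  have ht0 : (0 : ℝ) < t := ht
  have ht1 : (t : ℝ) ≤ 1 := t.2.2
  have hpos : ∀ j, 0 < axisState A t j := by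
    intro j
    by_cases hj : j ∈ A.1
    · rwa [h1 j hj]
    · rw [h2 j hj]; exact mul_pos hc ht0
  have key : ∀ i ∈ B.1, ∀ j ∉ B.1, i ∈ A.1 ∧ j ∉ A.1 := by
    intro i hi j hj
    have h3 := lt_of_ratio_lt_one hlt hi hj (hpos j)
    have hct : c * t ≤ c := by nlinarith
    by_cases hiA : i ∈ A.1 <;> by_cases hjA : j ∈ A.1
    · rw [h1 i hiA, h1 j hjA] at h3; exact absurd h3 (lt_irrefl _)
    · exact ⟨hiA, hjA⟩
    · rw [h2 i hiA, h1 j hjA] at h3; linarith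
    · rw [h2 i hiA, h2 j hjA] at h3; exact absurd h3 (lt_irrefl _)
  obtain ⟨i₀, hi₀⟩ := B.2.1
  obtain ⟨j₀, hj₀⟩ := B.exists_notMem
  refine h (Subtype.ext (Finset.ext fun k => ⟨fun hk => (key k hk j₀ hj₀).1, fun hk => ?_⟩))
  by_contra hkB
  exact (key i₀ hi₀ k hkB).2 hk

theorem topSet_axisState {A : Face n} {t : I} (ht : t < 1) : topSet (axisState A t) = A.1 := by
  obtain ⟨c, hc, h1, h2⟩ := exists_axisState_eq A t
  have ht' : (t : ℝ) < 1 := ht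
  have hct : c * t < c := by nlinarith
  ext i
  constructor
  · intro h
    by_contra hi
    obtain ⟨k, hk⟩ := A.2.1
    have := h k
    rw [h1 k hk, h2 i hi] at this
    linarith
  · intro hi j
    rw [h1 i hi]
    by_cases hj : j ∈ A.1
    · rw [h1 j hj]
    · rw [h2 j hj]; exact hct.le

theorem isBot_axisState_one (A : Face n) : IsBot (axisState A 1) := fun _ =>
  axisState_le_iff.2 unitInterval.le_one'

/-- The uniform distribution on `A` is the greatest lower bound of the pure states in `A`. -/
theorem le_axisState_zero_iff {A : Face n} {x : State n} :
    x ≤ axisState A 0 ↔ ∀ i ∈ A.1, x ≤ pureState i := by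
  obtain ⟨c, hc, h1, h2⟩ := exists_axisState_eq A 0
  simp only [le_pureState_iff]
  rw [le_iff]
  constructor
  · intro h i hi j
    by_contra! hj
    have h3 := h j i hj
    rw [h1 i hi] at h3
    by_cases hjA : j ∈ A.1
    · rw [h1 j hjA] at h3
      nlinarith
    · rw [h2 j hjA] at h3
      simp at h3
      nlinarith [x.nonneg i]
  · intro h i j hij
    have hj : j ∉ A.1 := fun hj => absurd (h j hj i) (not_le.2 hij)
    rw [h2 j hj]
    simpa using mul_nonneg (x.nonneg j) ((axisState A 0).nonneg i)

/-! ### Gauging the axes -/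

/-- The unnormalized value at `i` of the state whose ratios are those of `x`, moved along `φ`. -/
noncomputable def gaugeWeight (φ : Face n → (I ≃o I)) (x : State n) (i : Fin n) : I :=
  ∏ A : Face n with i ∉ A.1, φ A (ratio A x)

theorem map_eq_zero_iff_of_orderIso (f : I ≃o I) {t : I} : f t = 0 ↔ t = 0 :=
  (f.injective.eq_iff' f.map_bot)

theorem map_eq_one_iff_of_orderIso (f : I ≃o I) {t : I} : f t = 1 ↔ t = 1 :=
  (f.injective.eq_iff' f.map_top)

theorem gaugeWeight_eq_zero_iff {φ : Face n → (I ≃o I)} {x : State n} {i : Fin n} :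
    gaugeWeight φ x i = 0 ↔ x i = 0 := by
  rw [gaugeWeight, Finset.prod_eq_zero_iff]
  constructor
  · rintro ⟨A, hA, h⟩
    rw [map_eq_zero_iff_of_orderIso] at h
    exact eq_zero_of_ratio_eq_zero h (by simpa using hA)
  · intro h
    obtain ⟨k, hk⟩ := x.exists_pos
    -- The support of x has ratio 0, and its factor kills the product.
    let A : Face n := ⟨Finset.univ.filter fun k => 0 < x k, ⟨k, by simpa using hk⟩, fun hA => by
      have := Finset.eq_univ_iff_forall.1 hA i
      simp [h] at this⟩
    refine ⟨A, by simp [A, h], ?_⟩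
    rw [map_eq_zero_iff_of_orderIso]
    refine _root_.le_antisymm ((ratio_le_iff zero_lt_one).2 fun a _ b hb => ?_) unitInterval.nonneg'
    simpa [A] using hb

theorem gaugeWeight_pos_iff {φ : Face n → (I ≃o I)} {x : State n} {i : Fin n} :
    0 < gaugeWeight φ x i ↔ 0 < x i := by
  rw [lt_iff_le_and_ne, lt_iff_le_and_ne, ne_comm, ne_comm (a := (0 : ℝ)), Ne, Ne,
    gaugeWeight_eq_zero_iff]
  simp [x.nonneg i]

/-- Only the faces that contain `i` but not `j` contribute to the ratio of the weights. -/
theorem gaugeWeight_eq_mul {φ : Face n → (I ≃o I)} {x : State n} {i j : Fin n} (hj : 0 < x j)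
    (hij : x j ≤ x i) : gaugeWeight φ x j =
      (∏ A : Face n with j ∉ A.1 ∧ i ∈ A.1, φ A (ratio A x)) * gaugeWeight φ x i := by
  have h1 : gaugeWeight φ x i = ∏ A : Face n with j ∉ A.1 ∧ i ∉ A.1, φ A (ratio A x) := by
    symm
    refine Finset.prod_subset (fun A hA => ?_) fun A hA hA' => ?_
    · simp only [Finset.mem_filter, Finset.mem_univ, true_and] at hA ⊢
      exact hA.2
    -- A face containing j but not i has ratio 1, because `x j ≤ x i`.
    · simp only [Finset.mem_filter, Finset.mem_univ, true_and, not_and_or, not_not] at hA hA'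
      have hjA : j ∈ A.1 := hA'.resolve_right hA
      rw [map_eq_one_iff_of_orderIso]
      by_contra hne
      exact absurd (lt_of_ratio_lt_one (lt_of_le_of_ne unitInterval.le_one' hne) hjA hA
        (hj.trans_le hij)) (not_lt.2 hij)
  rw [h1, gaugeWeight, ← Finset.prod_filter_mul_prod_filter_not _ fun A : Face n => i ∈ A.1,
    Finset.filter_filter, Finset.filter_filter]

theorem gaugeWeight_mono {φ : Face n → (I ≃o I)} {x : State n} {i j : Fin n}
    (hij : x j ≤ x i) : gaugeWeight φ x j ≤ gaugeWeight φ x i := by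
  rcases (x.nonneg j).eq_or_lt with h0 | h0
  · rw [gaugeWeight_eq_zero_iff.2 h0.symm]
    exact unitInterval.nonneg'
  · rw [gaugeWeight_eq_mul h0 hij]
    exact mul_le_of_le_one_left' unitInterval.le_one'

/-- The state whose ratios are those of `x`, moved along `φ`. -/
noncomputable def gauge (φ : Face n → (I ≃o I)) (x : State n) : State n :=
  normalize (fun i => gaugeWeight φ x i) (fun i => (gaugeWeight φ x i).2.1) (by
    obtain ⟨i, hi⟩ := x.exists_pos
    exact ⟨i, gaugeWeight_pos_iff.2 hi⟩)

theorem ratio_gauge_le_iff {φ : Face n → (I ≃o I)} {x : State n} {A : Face n} {t : I}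
    (ht : t < 1) : ratio A (gauge φ x) ≤ t ↔
      ∀ i ∈ A.1, ∀ j ∉ A.1, gaugeWeight φ x j ≤ t * gaugeWeight φ x i := by
  obtain ⟨c, hc, h⟩ := exists_normalize_eq (fun i => (gaugeWeight φ x i : ℝ))
    (fun i => (gaugeWeight φ x i).2.1) (by
      obtain ⟨i, hi⟩ := x.exists_pos
      exact ⟨i, gaugeWeight_pos_iff.2 hi⟩)
  rw [ratio_le_iff ht]
  refine forall₂_congr fun i _ => forall₂_congr fun j _ => ?_
  rw [gauge, h, h, mul_left_comm, mul_le_mul_iff_right₀ hc, ← Subtype.coe_le_coe]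
  rfl

theorem ratio_gauge (φ : Face n → (I ≃o I)) (A : Face n) (x : State n) :
    ratio A (gauge φ x) = φ A (ratio A x) := by
  have key : ∀ t : I, t < 1 → (ratio A (gauge φ x) ≤ t ↔ φ A (ratio A x) ≤ t) := by
    intro t ht
    rw [ratio_gauge_le_iff ht]
    constructor
    · intro h
      by_cases hex : ∃ k ∉ A.1, 0 < x k
      · obtain ⟨k, hkA, hk⟩ := hex
        -- The extremal pair across `A`: no face other than `A` separates i from j with ratio below
        -- 1, so the quotient of their weights is the single factor of `A`.
        obtain ⟨j, hjA, hj⟩ := Finset.exists_max_image A.1ᶜ x.val ⟨k, by simpa using hkA⟩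
        obtain ⟨i, hiA, hi⟩ := Finset.exists_min_image A.1 x.val A.2.1
        simp only [Finset.mem_compl] at hjA hj
        have hxj : 0 < x j := hk.trans_le (hj k hkA)
        have hw := h i hiA j hjA
        have hwj : 0 < gaugeWeight φ x j := gaugeWeight_pos_iff.2 hxj
        have hwi : 0 < gaugeWeight φ x i := by
          refine lt_of_le_of_ne unitInterval.nonneg' fun h0 => ?_
          rw [← h0, mul_zero] at hw
          exact absurd hw (not_le.2 hwj)
        have hlt : x j < x i := by
          by_contra! hle
          have h1 : gaugeWeight φ x i ≤ t * gaugeWeight φ x i := (gaugeWeight_mono hle).trans hw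
          have h2 : (gaugeWeight φ x i : ℝ) ≤ t * gaugeWeight φ x i := h1
          have h3 : (0 : ℝ) < gaugeWeight φ x i := hwi
          have h4 : (t : ℝ) < 1 := ht
          nlinarith
        have hprod : ∏ B : Face n with j ∉ B.1 ∧ i ∈ B.1, φ B (ratio B x) =
            φ A (ratio A x) := by
          refine Finset.prod_eq_single_of_mem A (by simp [hjA, hiA]) fun B hB hne => ?_
          simp only [Finset.mem_filter, Finset.mem_univ, true_and] at hB
          rw [map_eq_one_iff_of_orderIso]
          by_contra h1
          have hB1 : ratio B x < 1 := lt_of_le_of_ne unitInterval.le_one' h1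
          refine hne (Subtype.ext (Finset.ext fun k => ⟨fun hkB => ?_, fun hkA => ?_⟩))
          · by_contra hkA
            exact absurd (lt_of_ratio_lt_one hB1 hkB hB.1 hxj) (not_lt.2 (hj k hkA))
          · by_contra hkB
            have hik := hi k hkA
            exact absurd (lt_of_ratio_lt_one hB1 hB.2 hkB ((hxj.trans hlt).trans_le hik))
              (not_lt.2 hik)
        rw [gaugeWeight_eq_mul hxj hlt.le, hprod] at hw
        exact le_of_mul_le_mul_right (a := (gaugeWeight φ x i : ℝ)) hw hwi
      · push Not at hex
        have : ratio A x = 0 :=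
          _root_.le_antisymm ((ratio_le_iff zero_lt_one).2 fun a _ b hb => by
            simpa using hex b hb) unitInterval.nonneg'
        rw [(map_eq_zero_iff_of_orderIso _).2 this]
        exact unitInterval.nonneg'
    · intro h i hi j hj
      rcases (x.nonneg j).eq_or_lt with h0 | h0
      · rw [gaugeWeight_eq_zero_iff.2 h0.symm]
        exact unitInterval.nonneg'
      have hA1 : ratio A x < 1 := by
        refine lt_of_le_of_ne unitInterval.le_one' fun h1 => ?_
        rw [(map_eq_one_iff_of_orderIso _).2 h1] at h
        exact absurd h (not_le.2 ht)
      rw [gaugeWeight_eq_mul h0 (lt_of_ratio_lt_one hA1 hi hj h0).le]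
      refine mul_le_mul_left ?_ _
      -- The factor of `A` occurs in the product, and the others are at most 1.
      rw [← Finset.mul_prod_erase _ _ (show A ∈ _ by simp [hi, hj])]
      exact (mul_le_of_le_one_right' unitInterval.le_one').trans h
  rcases eq_or_lt_of_le (unitInterval.le_one' : φ A (ratio A x) ≤ 1) with h1 | h1
  · rw [h1]
    by_contra hne
    have h2 := lt_of_le_of_ne (unitInterval.le_one' (t := ratio A (gauge φ x))) hne
    have h3 := (key _ h2).1 le_rfl
    rw [h1] at h3
    exact absurd h3 (not_le.2 h2)
  · have h2 := (key _ h1).2 le_rfl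
    exact _root_.le_antisymm h2 ((key _ (h2.trans_lt h1)).1 le_rfl)

/-- Moving all ratios is an order-isomorphism. -/
noncomputable def gaugeIso (φ : Face n → (I ≃o I)) : State n ≃o State n where
  toFun := gauge φ
  invFun := gauge fun A => (φ A).symm
  left_inv x := State.ext_ratio fun A => by simp [ratio_gauge]
  right_inv x := State.ext_ratio fun A => by simp [ratio_gauge]
  map_rel_iff' := by
    intro x y
    simp [le_iff_ratio_le, ratio_gauge]

theorem gaugeIso_axisState (φ : Face n → (I ≃o I)) (A : Face n) (t : I) :
    gaugeIso φ (axisState A t) = axisState A (φ A t) := by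
  refine State.le_antisymm ?_ ?_
  · rw [← OrderIso.le_symm_apply, axisState_le_iff]
    change ratio A (gauge (fun A => (φ A).symm) _) ≤ t
    simp [ratio_gauge, ratio_axisState]
  · rw [axisState_le_iff]
    change ratio A (gauge φ _) ≤ φ A t
    simp [ratio_gauge, ratio_axisState]

/-! ### Relabelling -/

theorem relabel_mono (τ : Equiv.Perm (Fin n)) {x y : State n} (h : x ≤ y) :
    relabel τ x ≤ relabel τ y :=
  le_iff.2 fun i j hij => le_iff.1 h (τ.symm i) (τ.symm j) hij

theorem relabel_symm_relabel (τ : Equiv.Perm (Fin n)) (x : State n) :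
    relabel τ.symm (relabel τ x) = x :=
  State.ext fun i => by simp [relabel]

theorem relabel_relabel_symm (τ : Equiv.Perm (Fin n)) (x : State n) :
    relabel τ (relabel τ.symm x) = x :=
  State.ext fun i => by simp [relabel]

/-- Relabelling as an order-isomorphism. -/
def relabelIso (τ : Equiv.Perm (Fin n)) : State n ≃o State n where
  toFun := relabel τ
  invFun := relabel τ.symm
  left_inv := relabel_symm_relabel τ
  right_inv := relabel_relabel_symm τ
  map_rel_iff' := by
    intro x y
    refine ⟨fun h => ?_, relabel_mono τ⟩
    simpa [relabel_symm_relabel] using relabel_mono τ.symm h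

theorem relabel_pureState (τ : Equiv.Perm (Fin n)) (i : Fin n) :
    relabel τ (pureState i) = pureState (τ i) := by
  refine State.ext fun j => ?_
  simp [relabel, pureState, Pi.single_apply, Equiv.symm_apply_eq]

/-- The image of a pure state lies below some pure state; pulling the latter back, maximality forces
equality. -/
theorem exists_perm_of_orderIso (h : State n ≃o State n) :
    ∃ τ : Equiv.Perm (Fin n), ∀ i, h (pureState i) = pureState (τ i) := by
  have key : ∀ i, ∃ j, h (pureState i) = pureState j := by
    intro i
    obtain ⟨j, hj⟩ := topSet_nonempty (h (pureState i))
    refine ⟨j, ?_⟩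
    have h1 : pureState i ≤ h.symm (pureState j) := by
      rw [OrderIso.le_symm_apply]
      exact le_pureState_iff.2 hj
    rw [← eq_of_pureState_le h1, OrderIso.apply_symm_apply]
  choose s hs using key
  have hinj : Function.Injective s := fun i j hij => by
    have : h (pureState i) = h (pureState j) := by rw [hs, hs, hij]
    exact pureState_injective (h.injective this)
  exact ⟨Equiv.ofBijective s (Finite.injective_iff_bijective.1 hinj), hs⟩

/-! ### Order-isomorphisms that fix the pure states -/

theorem topSet_map {h : State n ≃o State n} (hp : ∀ i, h (pureState i) = pureState i)
    (x : State n) : topSet (h x) = topSet x := by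
  ext i
  rw [← le_pureState_iff, ← le_pureState_iff, ← hp i, h.le_iff_le, hp]

/-- The end point is an infimum of fixed pure states. It is treated apart because its lower set need
not be a chain. -/
theorem map_axisState_zero {h : State n ≃o State n} (hp : ∀ i, h (pureState i) = pureState i)
    (A : Face n) : h (axisState A 0) = axisState A 0 := by
  have key : ∀ g : State n ≃o State n, (∀ i, g (pureState i) = pureState i) →
      g (axisState A 0) ≤ axisState A 0 := by
    intro g hg
    refine le_axisState_zero_iff.2 fun i hi => ?_
    rw [le_pureState_iff, topSet_map hg, topSet_axisState zero_lt_one]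
    exact hi
  refine State.le_antisymm (key h hp) ?_
  rw [← OrderIso.symm_apply_le]
  exact key h.symm fun i => by rw [OrderIso.symm_apply_eq, hp]

theorem IsBot.map {h : State n ≃o State n} {x : State n} (hx : IsBot x) : IsBot (h x) := fun y => by
  rw [← OrderIso.le_symm_apply]
  exact hx _

theorem topSet_eq_univ_of_isBot {x : State n} (hx : IsBot x) : topSet x = Set.univ :=
  Set.eq_univ_of_forall fun i j => (isBot_iff.1 hx j i).le

/-- The states whose lower set is a chain. -/
def ChainBelow (x : State n) : Prop := ∀ a b, a ≤ x → b ≤ x → a ≤ b ∨ b ≤ a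

theorem ChainBelow.map {h : State n ≃o State n} {x : State n} (hx : ChainBelow x) :
    ChainBelow (h x) := fun a b ha hb => by
  rw [← OrderIso.symm_apply_le] at ha hb
  simpa using hx _ _ ha hb

theorem eq_axisState_of_ratio_eq_one {A : Face n} {x : State n}
    (h : ∀ B, B ≠ A → ratio B x = 1) : x = axisState A (ratio A x) := by
  refine State.le_antisymm (le_iff_ratio_le.2 fun B => ?_) (axisState_le_iff.2 le_rfl)
  by_cases hB : B = A
  · rw [hB, ratio_axisState]
  · rw [h B hB]; exact unitInterval.le_one'

/-- Going down only raises ratios, so those equal to 1 stay 1 and a single ratio is left to vary. -/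
theorem chainBelow_axisState (A : Face n) {t : I} (ht : 0 < t) : ChainBelow (axisState A t) := by
  have key : ∀ a, a ≤ axisState A t → a = axisState A (ratio A a) := fun a ha =>
    eq_axisState_of_ratio_eq_one fun B hB => by
      refine _root_.le_antisymm unitInterval.le_one' ?_
      rw [← ratio_axisState_of_ne hB ht]
      exact ratio_antitone ha B
  intro a b ha hb
  rw [key a ha, key b hb, axisState_le_axisState_iff, axisState_le_axisState_iff]
  exact le_total _ _

theorem ChainBelow.exists_eq_axisState {x : State n} (hx : ChainBelow x) (A₀ : Face n) :
    ∃ A t, x = axisState A t := by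
  by_cases hex : ∃ A, ratio A x < 1
  · obtain ⟨A, hA⟩ := hex
    refine ⟨A, _, eq_axisState_of_ratio_eq_one fun B hBA => ?_⟩
    by_contra hne
    have hB : ratio B x < 1 := lt_of_le_of_ne unitInterval.le_one' hne
    have key : ∀ {A B : Face n}, B ≠ A → ∀ s t : I, s < 1 → 0 < t →
        ¬ axisState B s ≤ axisState A t := by
      intro A B hne s t hs ht hle
      rw [axisState_le_iff, ratio_axisState_of_ne hne ht] at hle
      exact absurd hle (not_le.2 hs)
    -- Moving strictly above both ratios gives parameters in the open interval, where points of
    -- distinct axes are incomparable.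
    obtain ⟨s, hs, hs1⟩ := exists_between hA
    obtain ⟨t, ht, ht1⟩ := exists_between hB
    have hs0 : 0 < s := lt_of_le_of_lt unitInterval.nonneg' hs
    have ht0 : 0 < t := lt_of_le_of_lt unitInterval.nonneg' ht
    rcases hx _ _ (axisState_le_iff.2 hs.le) (axisState_le_iff.2 ht.le) with h | h
    · exact key hBA.symm s t hs1 ht0 h
    · exact key hBA t s ht1 hs0 h
  · push Not at hex
    exact ⟨A₀, _, eq_axisState_of_ratio_eq_one fun B _ =>
      _root_.le_antisymm unitInterval.le_one' (hex B)⟩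

theorem exists_map_axisState {h : State n ≃o State n} (hp : ∀ i, h (pureState i) = pureState i)
    (A : Face n) (t : I) : ∃ s, h (axisState A t) = axisState A s := by
  rcases eq_or_lt_of_le (unitInterval.nonneg' : 0 ≤ t) with h0 | h0
  · exact ⟨0, by rw [← h0]; exact map_axisState_zero hp A⟩
  rcases eq_or_lt_of_le (unitInterval.le_one' : t ≤ 1) with h1 | h1
  · rw [h1]
    exact ⟨1, State.le_antisymm (IsBot.map (isBot_axisState_one A) _) (isBot_axisState_one A _)⟩
  -- The chain condition puts the image on some axis; the preserved top indices then force `B = A`.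
  obtain ⟨B, s, hs⟩ := ((chainBelow_axisState A h0).map (h := h)).exists_eq_axisState A
  have htop : topSet (axisState B s) = A.1 := by
    rw [← hs, topSet_map hp, topSet_axisState h1]
  rcases eq_or_lt_of_le (unitInterval.le_one' : s ≤ 1) with hs1 | hs1
  · rw [hs1, topSet_eq_univ_of_isBot (isBot_axisState_one B)] at htop
    exact absurd (Finset.coe_eq_univ.1 htop.symm) A.2.2
  · rw [topSet_axisState hs1] at htop
    rw [Subtype.ext (Finset.coe_injective htop)] at hs
    exact ⟨s, hs⟩

/-- An order-isomorphism is determined by its values on the axes. -/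
theorem orderIso_ext_axisState {g h : State n ≃o State n}
    (hgh : ∀ A t, g (axisState A t) = h (axisState A t)) : g = h := by
  have key : ∀ {g h : State n ≃o State n}, (∀ A t, g (axisState A t) = h (axisState A t)) →
      ∀ x, g x ≤ h x := by
    intro g h hgh x
    rw [← OrderIso.le_symm_apply, le_iff_ratio_le]
    intro A
    rw [← axisState_le_iff, OrderIso.le_symm_apply, hgh, h.le_iff_le, axisState_le_iff]
  ext1
  funext x
  exact State.le_antisymm (key hgh x) (key (fun A t => (hgh A t).symm) x)

/-! ### Axes -/

theorem axisState_mem_coord (A : Face n) (t : I) : axisState A t ∈ Coord n := by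
  obtain ⟨c, hc, h1, h2⟩ := exists_axisState_eq A t
  have hsub : spec (axisState A t) ⊆ {c, c * t} := by
    rintro _ ⟨i, rfl⟩
    by_cases hi : i ∈ A.1
    · exact Or.inl (h1 i hi)
    · exact Or.inr (h2 i hi)
  exact (Set.ncard_le_ncard hsub (Set.toFinite _)).trans
    ((Set.ncard_insert_le _ _).trans (by simp))

theorem exists_eq_axisState_of_topSet_eq {A : Face n} {y : State n} (hy : y ∈ Coord n)
    (h : topSet y = A.1) : ∃ t, y = axisState A t := by
  obtain ⟨i₀, hi₀⟩ := A.2.1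
  obtain ⟨j₀, hj₀⟩ := A.exists_notMem
  have hA : ∀ {i}, i ∈ A.1 → i ∈ topSet y := fun hi => by rw [h]; exact hi
  have hconst : ∀ i ∈ A.1, y i = y i₀ := fun i hi =>
    _root_.le_antisymm (hA hi₀ i) (hA hi i₀)
  have hlt : ∀ j ∉ A.1, y j < y i₀ := by
    intro j hj
    refine lt_of_le_of_ne (hA hi₀ j) fun heq => hj ?_
    have : j ∈ topSet y := fun k => heq ▸ hA hi₀ k
    rw [h] at this
    exact this
  have hoff : ∀ j ∉ A.1, y j = y j₀ := by
    intro j hj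
    by_contra hne
    -- Two different values off `A` would give three in all, counting the maximum.
    have : 2 < (spec y).ncard := (Set.two_lt_ncard_iff (Set.finite_range _)).2
      ⟨y j, y j₀, y i₀, ⟨j, rfl⟩, ⟨j₀, rfl⟩, ⟨i₀, rfl⟩, hne, (hlt j hj).ne, (hlt j₀ hj₀).ne⟩
    exact absurd hy (not_le.2 this)
  have hpos : 0 < y i₀ := (y.nonneg j₀).trans_lt (hlt j₀ hj₀)
  let t : I := ⟨y j₀ / y i₀, div_nonneg (y.nonneg _) hpos.le, (div_le_one hpos).2 (hlt j₀ hj₀).le⟩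
  refine ⟨t, ?_⟩
  obtain ⟨c, hc, h1, h2⟩ := exists_axisState_eq A t
  have ht : y i₀ * (c * t) = y j₀ * c := by
    simp only [t]
    field_simp
  refine State.ext_of_proportional fun i j => ?_
  by_cases hi : i ∈ A.1 <;> by_cases hj : j ∈ A.1
  · rw [hconst i hi, hconst j hj, h1 i hi, h1 j hj]
  · rw [hconst i hi, hoff j hj, h1 i hi, h2 j hj, ht]
  · rw [hoff i hi, hconst j hj, h2 i hi, h1 j hj, ht]
  · rw [hoff i hi, hoff j hj, h2 i hi, h2 j hj]

/-- The end point of the axis of a face: the uniform distribution on the face. -/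
noncomputable def uniformState (A : Face n) : Ir n :=
  ⟨axisState A 0, axisState_mem_coord A 0, by
    obtain ⟨c, -, -, h2⟩ := exists_axisState_eq A 0
    obtain ⟨j, hj⟩ := A.exists_notMem
    exact ⟨j, by simpa using h2 j hj⟩⟩

theorem mem_axis_uniformState_iff {A : Face n} {y : State n} :
    y ∈ axis (uniformState A).1 ↔ ∃ t, y = axisState A t := by
  have htop : topSet (uniformState A).1 = A.1 := topSet_axisState zero_lt_one
  constructor
  · rintro ⟨hy, h | h⟩
    · exact exists_eq_axisState_of_topSet_eq hy (h.trans htop)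
    · exact ⟨1, State.le_antisymm (h _) (isBot_axisState_one A _)⟩
  · rintro ⟨t, rfl⟩
    refine ⟨axisState_mem_coord A t, ?_⟩
    rcases eq_or_lt_of_le (unitInterval.le_one' : t ≤ 1) with ht | ht
    · exact Or.inr (ht ▸ isBot_axisState_one A)
    · exact Or.inl ((topSet_axisState ht).trans htop.symm)

theorem uniformState_bijective : Function.Bijective (uniformState : Face n → Ir n) := by
  classical
  constructor
  · intro A B h
    have h1 : axisState A 0 = axisState B 0 := congrArg Subtype.val h
    have h2 := congrArg topSet h1
    rw [topSet_axisState zero_lt_one, topSet_axisState zero_lt_one] at h2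
    exact Subtype.ext (Finset.coe_injective h2)
  · rintro ⟨x, hx, i, hi⟩
    obtain ⟨k, hk⟩ := x.exists_pos
    let A : Face n := ⟨(topSet x).toFinset, by simpa using topSet_nonempty x, fun hA => by
      have : i ∈ topSet x := by rw [← Set.mem_toFinset, hA]; exact Finset.mem_univ i
      exact absurd (this k) (by rw [hi]; exact not_le.2 hk)⟩
    obtain ⟨t, ht⟩ := exists_eq_axisState_of_topSet_eq hx
      (show topSet x = A.1 from (Set.coe_toFinset _).symm)
    have ht0 : t = 0 := by
      obtain ⟨c, hc, h1, h2⟩ := exists_axisState_eq A t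
      rw [ht] at hi
      by_cases hiA : i ∈ A.1
      · rw [h1 i hiA] at hi; exact absurd hi hc.ne'
      · rw [h2 i hiA] at hi
        exact Subtype.ext ((mul_eq_zero.1 hi).resolve_left hc.ne')
    refine ⟨A, Subtype.ext ?_⟩
    exact (ht0 ▸ ht : x = axisState A 0).symm

theorem card_face (hn : 2 ≤ n) : Nat.card (Face n) = 2 ^ n - 2 := by
  have : NeZero n := ⟨by omega⟩
  have h : ∀ A : Finset (Fin n), (A.Nonempty ∧ A ≠ Finset.univ) ↔
      A ∈ (({∅, Finset.univ} : Finset (Finset (Fin n))))ᶜ := by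
    intro A
    simp [Finset.nonempty_iff_ne_empty]
  rw [Nat.card_congr (Equiv.subtypeEquivRight h), Nat.card_eq_fintype_card, Fintype.card_coe,
    Finset.card_compl, Finset.card_pair Finset.univ_nonempty.ne_empty.symm]
  simp

/-- The axis of a face, parametrized by the ratio. -/
noncomputable def axisEquiv (A : Face n) : I ≃ axis (uniformState A).1 where
  toFun t := ⟨axisState A t, mem_axis_uniformState_iff.2 ⟨t, rfl⟩⟩
  invFun y := ratio A y.1
  left_inv t := ratio_axisState A t
  right_inv := by
    rintro ⟨y, hy⟩
    obtain ⟨t, rfl⟩ := mem_axis_uniformState_iff.1 hy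
    exact Subtype.ext (congrArg (axisState A) (ratio_axisState A t))

theorem axisEquiv_le_iff {A : Face n} {s t : I} : axisEquiv A s ≤ axisEquiv A t ↔ t ≤ s :=
  axisState_le_axisState_iff

theorem axisEquiv_symm_le_iff {A : Face n} {y z : axis (uniformState A).1} :
    (axisEquiv A).symm y ≤ (axisEquiv A).symm z ↔ z ≤ y := by
  rw [← axisEquiv_le_iff, Equiv.apply_symm_apply, Equiv.apply_symm_apply]

/-- The chart of an axis that sends the state with ratio `t` to `1 - t`. -/
noncomputable def axisChart (A : Face n) : axis (uniformState A).1 ≃o I where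
  toEquiv := (axisEquiv A).symm.trans (Function.Involutive.toPerm _ unitInterval.symm_involutive)
  map_rel_iff' := by
    intro y z
    change unitInterval.symm _ ≤ unitInterval.symm _ ↔ _
    rw [unitInterval.symm_le_symm, axisEquiv_symm_le_iff]

/-- An order-isomorphism of an axis, read off on the ratios. -/
noncomputable def axisConj (A : Face n)
    (g : axis (uniformState A).1 ≃o axis (uniformState A).1) : I ≃o I where
  toEquiv := ((axisEquiv A).trans g.toEquiv).trans (axisEquiv A).symm
  map_rel_iff' := by
    intro s t
    change (axisEquiv A).symm (g (axisEquiv A s)) ≤ (axisEquiv A).symm (g (axisEquiv A t)) ↔ _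
    rw [axisEquiv_symm_le_iff, g.le_iff_le, axisEquiv_le_iff]

theorem axisState_axisConj (A : Face n)
    (g : axis (uniformState A).1 ≃o axis (uniformState A).1) (t : I) :
    axisState A (axisConj A g t) = (g (axisEquiv A t)).1 :=
  congrArg Subtype.val ((axisEquiv A).apply_symm_apply (g (axisEquiv A t)))

/-- The restriction to an axis of an order-isomorphism that fixes the pure states. -/
def axisRestrict {h : State n ≃o State n} (hp : ∀ i, h (pureState i) = pureState i) (A : Face n) :
    axis (uniformState A).1 ≃o axis (uniformState A).1 where
  toFun y := ⟨h y.1, by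
    obtain ⟨t, ht⟩ := mem_axis_uniformState_iff.1 y.2
    rw [ht]
    exact mem_axis_uniformState_iff.2 (exists_map_axisState hp A t)⟩
  invFun y := ⟨h.symm y.1, by
    obtain ⟨t, ht⟩ := mem_axis_uniformState_iff.1 y.2
    rw [ht]
    exact mem_axis_uniformState_iff.2
      (exists_map_axisState (fun i => by rw [OrderIso.symm_apply_eq, hp]) A t)⟩
  left_inv y := Subtype.ext (h.symm_apply_apply y.1)
  right_inv y := Subtype.ext (h.apply_symm_apply y.1)
  map_rel_iff' := h.le_iff_le

/-! ### Labellings and gauges -/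

section HasData

variable {θ : ∀ x : Ir n, axis x.1 ≃o Set.Icc (0 : ℝ) 1}

theorem exists_hasData (h : State n ≃o State n) : ∃ p : Equiv.Perm (Fin n) ×
    (Ir n → (Set.Icc (0 : ℝ) 1 ≃o Set.Icc (0 : ℝ) 1)), HasData θ h p.1 p.2 := by
  obtain ⟨τ, hτ⟩ := exists_perm_of_orderIso h
  -- Undoing the relabelling leaves an automorphism that fixes the pure states, so it restricts to
  -- each axis.
  let g := h.trans (relabelIso τ).symm
  have hg : ∀ x, h x = relabel τ (g x) := fun x => (relabel_relabel_symm τ (h x)).symm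
  have hp : ∀ i, g (pureState i) = pureState i := fun i => by
    change relabel τ.symm (h (pureState i)) = _
    rw [hτ, relabel_pureState, Equiv.symm_apply_apply]
  have key : ∀ x : Ir n, ∃ f : Set.Icc (0 : ℝ) 1 ≃o Set.Icc (0 : ℝ) 1, ∀ y : axis x.1,
      h y = relabel τ ((θ x).symm (f (θ x y))).1 := by
    intro x
    obtain ⟨A, rfl⟩ := uniformState_bijective.2 x
    refine ⟨((θ _).symm.trans (axisRestrict hp A)).trans (θ _), fun y => ?_⟩
    simp only [OrderIso.trans_apply, OrderIso.symm_apply_apply]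
    exact hg y
  choose f hf using key
  exact ⟨(τ, f), hτ, hf⟩

theorem HasData.unique {h : State n ≃o State n} {p q : Equiv.Perm (Fin n) ×
    (Ir n → (Set.Icc (0 : ℝ) 1 ≃o Set.Icc (0 : ℝ) 1))} (hp : HasData θ h p.1 p.2)
    (hq : HasData θ h q.1 q.2) : p = q := by
  obtain ⟨τ, f⟩ := p
  obtain ⟨τ', f'⟩ := q
  obtain rfl : τ = τ' := Equiv.ext fun i =>
    pureState_injective ((hp.1 i).symm.trans (hq.1 i))
  congr 1
  funext x
  ext1
  funext t
  have h1 := (hp.2 x ((θ x).symm t)).symm.trans (hq.2 x ((θ x).symm t))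
  have h2 := (relabelIso τ).injective h1
  simpa using (θ x).symm.injective (Subtype.ext h2)

theorem HasData.orderIso_unique {g h : State n ≃o State n} {p : Equiv.Perm (Fin n) ×
    (Ir n → (Set.Icc (0 : ℝ) 1 ≃o Set.Icc (0 : ℝ) 1))} (hg : HasData θ g p.1 p.2)
    (hh : HasData θ h p.1 p.2) : g = h :=
  orderIso_ext_axisState fun A t =>
    (hg.2 _ (axisEquiv A t)).trans (hh.2 _ (axisEquiv A t)).symm

theorem gaugeIso_pureState (hn : 2 ≤ n) (φ : Face n → (I ≃o I)) (i : Fin n) :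
    gaugeIso φ (pureState i) = pureState i := by
  -- A singleton is a proper face because `2 ≤ n`; the pure state is the end point of its axis, and
  -- gauges fix the ratio 0.
  let A : Face n := ⟨{i}, Finset.singleton_nonempty i, fun hA => by
    have := congrArg Finset.card hA
    simp at this
    omega⟩
  have hA : axisState A 0 = pureState i :=
    eq_of_pureState_le (le_axisState_zero_iff.2 fun j hj => by
      rw [Finset.mem_singleton.1 hj]
      exact State.le_refl _)
  rw [← hA, gaugeIso_axisState, (map_eq_zero_iff_of_orderIso _).2 rfl]

theorem exists_orderIso_hasData (hn : 2 ≤ n) (p : Equiv.Perm (Fin n) ×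
    (Ir n → (Set.Icc (0 : ℝ) 1 ≃o Set.Icc (0 : ℝ) 1))) : ∃ h, HasData θ h p.1 p.2 := by
  obtain ⟨τ, f⟩ := p
  -- The gauge is transported from the chart to the ratio coordinate. That coordinate reverses the
  -- order, but conjugation uses it twice, so the result is increasing.
  let φ : Face n → (I ≃o I) := fun A =>
    axisConj A (((θ _).trans (f (uniformState A))).trans (θ _).symm)
  refine ⟨(gaugeIso φ).trans (relabelIso τ), fun i => ?_, fun x y => ?_⟩
  · rw [OrderIso.trans_apply, gaugeIso_pureState hn]
    exact relabel_pureState τ i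
  · obtain ⟨A, rfl⟩ := uniformState_bijective.2 x
    obtain ⟨t, rfl⟩ := (axisEquiv A).surjective y
    change relabel τ (gaugeIso φ (axisState A t)) = _
    rw [gaugeIso_axisState, axisState_axisConj]
    rfl

end HasData

end BayesianOrder

theorem mainTheorem2 (n : ℕ) (hn : 2 ≤ n) :
    Nat.card (BayesianOrder.Ir n) = 2 ^ n - 2 ∧
    (∀ x : BayesianOrder.Ir n, Nonempty (BayesianOrder.axis x.1 ≃o Set.Icc (0 : ℝ) 1)) ∧
    ∀ θ : (∀ x : BayesianOrder.Ir n, BayesianOrder.axis x.1 ≃o Set.Icc (0 : ℝ) 1),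
      ∃ Φ : (BayesianOrder.State n ≃o BayesianOrder.State n) ≃
          Equiv.Perm (Fin n) ×
            (BayesianOrder.Ir n → (Set.Icc (0 : ℝ) 1 ≃o Set.Icc (0 : ℝ) 1)),
        ∀ h σ f, Φ h = (σ, f) ↔ BayesianOrder.HasData θ h σ f := by
  refine ⟨?_, fun x => ?_, fun θ => ?_⟩
  · rw [← BayesianOrder.card_face hn]
    exact (Nat.card_congr (Equiv.ofBijective _ BayesianOrder.uniformState_bijective)).symm
  · obtain ⟨A, rfl⟩ := BayesianOrder.uniformState_bijective.2 x
    exact ⟨BayesianOrder.axisChart A⟩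
  · choose F hF using BayesianOrder.exists_hasData (θ := θ)
    have hbij : Function.Bijective F := by
      refine ⟨fun g h hgh => (hF g).orderIso_unique (hgh ▸ hF h), fun p => ?_⟩
      obtain ⟨h, hh⟩ := BayesianOrder.exists_orderIso_hasData (θ := θ) hn p
      exact ⟨h, (hF h).unique hh⟩
    refine ⟨Equiv.ofBijective F hbij, fun h σ f => ⟨fun heq => ?_, fun hd => ?_⟩⟩
    · have heq' : F h = (σ, f) := heq
      simpa [heq'] using hF h
    · exact (hF h).unique (q := (σ, f)) hd
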